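/- **Theorem (label inversion).** *Setting.* Let $g,m,\ell>0$, $\sigma\ge 0$, and let $P_\pm,\varepsilon_\pm,\delta_\pm\in C^\infty((0,\infty))$ with $P_\pm>0$ strictly increasing, $1/P_\pm'\in L^\infty_{loc}((0,\infty))$, $\varepsilon_\pm>0$, $\delta_\pm\ge 0$. Put $h_\pm(z)=\int_1^z P_\pm'(r)/r\,dr$. Let $\rho_0^->0$ satisfy $P_-(\rho_0^-)>P_+(\rho_0^-)$ and $P_-(\rho_0^-)\in P_+((0,\infty))$, let $\rho_0^+=P_+^{-1}(P_-(\rho_0^-))$ and $[\![\rho_0]\!]=\rho_0^+-\rho_0^->0$, and assume $h_-(\rho_0^-)+gm\in h_-((0,\infty))$ and $h_+(\rho_0^+)-g\ell\in h_+((0,\infty))$. Define on $(-m,\ell)$ the steady density $$\rho_0(x)=h_-^{-1}(h_-(\rho_0^-)-gx)\ (x<0),\qquad \rho_0(x)=h_+^{-1}(h_+(\rho_0^+)-gx)\ (x>0),$$ and write $P'(\rho_0),\varepsilon_0=\varepsilon(\rho_0),\delta_0=\delta(\rho_0)$, where $P,\varepsilon,\delta$ carry the subscript $-$ for $x<0$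 and $+$ for $x>0$. Let $\xi\in\mathbb{R}^2$ with $0<|\xi|^2<g[\![\rho_0]\!]/\sigma$ (if $\sigma=0$: any $\xi\ne 0$). For $s>0$ and real-valued $\varphi,\psi\in H_0^1((-m,\ell))$ let $$E(\varphi,\psi;s)=\frac{\sigma|\xi|^2}{2}\psi(0)^2+\frac12\int_{-m}^{\ell}\Big[(s\delta_0+P'(\rho_0)\rho_0)(\psi'+|\xi|\varphi)^2-2g\rho_0|\xi|\varphi\psi\Big]dx+\frac12\int_{-m}^{\ell}s\varepsilon_0\Big[(\varphi'-|\xi|\psi)^2+(\psi'-|\xi|\varphi)^2+\tfrac13(\psi'+|\xi|\varphi)^2\Big]dx,$$ $$J(\varphi,\psi)=\frac12\int_{-m}^{\ell}\rho_0(\varphi^2+\psi^2)\,dx,\qquad \mathcal A=\{(\varphi,\psi)\in H_0^1\times H_0^1: J(\varphi,\psi)=1\},$$ $$\mu(s)=\inf_{(\varphi,\psi)\in\mathcal A}E(\varphi,\psi;s),\qquad \mathcal S=\{s\in(0,\infty):\mu(s)<0\},\qquad \lambda(|\xi|,s)=\sqrt{-\mu(s)}\ \text{ for } s\in\mathcal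 S.$$ *Conclusion.* For every $s>0$ the infimum $\mu(s)$ is finite ($\mathcal A\neq\varnothing$ and $E(\cdot;s)$ is bounded below on $\mathcal A$), and there exists a unique $s\in\mathcal S$ such that $\lambda(|\xi|,s)=\sqrt{-\mu(s)}>0$ and $s=\lambda(|\xi|,s)$. -/

import Mathlib

open Set MeasureTheory
open scoped ContDiff NNReal ENNReal

namespace RayleighTaylor

noncomputable section

/-- The data of the two-fluid problem in the slab `-m < x₃ < ℓ`. A subscript `m` / `p` stands for
the lower (`-`) / upper (`+`) fluid. `rhom` is the density of the lower fluid at the interface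
`x₃ = 0`. -/
structure FluidData where
  /-- pressure laws -/
  Pm : ℝ → ℝ
  Pp : ℝ → ℝ
  /-- shear viscosities -/
  epsm : ℝ → ℝ
  epsp : ℝ → ℝ
  /-- bulk viscosities -/
  delm : ℝ → ℝ
  delp : ℝ → ℝ
  /-- gravity -/
  g : ℝ
  /-- surface tension -/
  σ : ℝ
  /-- depth of the lower fluid -/
  m : ℝ
  /-- height of the upper fluid -/
  ℓ : ℝ
  /-- density of the lower fluid at the interface -/
  rhom : ℝ

/-- A pressure law: positive, smooth and strictly increasing on `(0, ∞)`, with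
`1 / P' ∈ L^∞_loc((0, ∞))` (where `1 / 0 = ∞`). -/
structure IsPressureLaw (P : ℝ → ℝ) : Prop where
  pos : ∀ z ∈ Ioi (0 : ℝ), 0 < P z
  smooth : ContDiffOn ℝ ∞ P (Ioi 0)
  strictMono : StrictMonoOn P (Ioi 0)
  inv_deriv_locallyBounded : ∀ K : Set ℝ, IsCompact K → K ⊆ Ioi 0 →
    ∃ C : ℝ≥0, ∀ᵐ z ∂(volume.restrict K), (ENNReal.ofReal (deriv P z))⁻¹ ≤ (C : ℝ≥0∞)

/-- The enthalpy `h(z) = ∫₁ᶻ P'(r) / r dr`. -/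
def enthalpy (P : ℝ → ℝ) (z : ℝ) : ℝ := ∫ r in (1 : ℝ)..z, deriv P r / r

namespace FluidData

variable (D : FluidData)

/-- The density of the upper fluid at the interface, `ρ₀⁺ = P₊⁻¹ (P₋ (ρ₀⁻))`,
with `P₊⁻¹` the inverse of `P₊` on `(0, ∞)`. -/
def rhop : ℝ := Function.invFunOn D.Pp (Ioi 0) (D.Pm D.rhom)

/-- The jump `⟦ρ₀⟧ = ρ₀⁺ - ρ₀⁻` of the density across the interface. -/
def jumpRho : ℝ := D.rhop - D.rhom

/-- The steady density profile: `h₋⁻¹ (h₋ (ρ₀⁻) - g x)` below the interface and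
`h₊⁻¹ (h₊ (ρ₀⁺) - g x)` above it. (The value at the single point `x = 0` plays no role.) -/
def rho0 (x : ℝ) : ℝ :=
  if x < 0 then
    Function.invFunOn (enthalpy D.Pm) (Ioi 0) (enthalpy D.Pm D.rhom - D.g * x)
  else
    Function.invFunOn (enthalpy D.Pp) (Ioi 0) (enthalpy D.Pp D.rhop - D.g * x)

/-- The shear viscosity `ε₀ = ε(ρ₀)` of the steady state. -/
def eps0 (x : ℝ) : ℝ := if x < 0 then D.epsm (D.rho0 x) else D.epsp (D.rho0 x)

/-- The bulk viscosity `δ₀ = δ(ρ₀)` of the steady state. -/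
def del0 (x : ℝ) : ℝ := if x < 0 then D.delm (D.rho0 x) else D.delp (D.rho0 x)

/-- `P'(ρ₀)` in the steady state. -/
def dP0 (x : ℝ) : ℝ := if x < 0 then deriv D.Pm (D.rho0 x) else deriv D.Pp (D.rho0 x)

/-- The standing assumptions on the data. -/
structure Admissible : Prop where
  pressure_m : IsPressureLaw D.Pm
  pressure_p : IsPressureLaw D.Pp
  epsm_smooth : ContDiffOn ℝ ∞ D.epsm (Ioi 0)
  epsp_smooth : ContDiffOn ℝ ∞ D.epsp (Ioi 0)
  delm_smooth : ContDiffOn ℝ ∞ D.delm (Ioi 0)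
  delp_smooth : ContDiffOn ℝ ∞ D.delp (Ioi 0)
  epsm_pos : ∀ z ∈ Ioi (0 : ℝ), 0 < D.epsm z
  epsp_pos : ∀ z ∈ Ioi (0 : ℝ), 0 < D.epsp z
  delm_nonneg : ∀ z ∈ Ioi (0 : ℝ), 0 ≤ D.delm z
  delp_nonneg : ∀ z ∈ Ioi (0 : ℝ), 0 ≤ D.delp z
  g_pos : 0 < D.g
  σ_nonneg : 0 ≤ D.σ
  m_pos : 0 < D.m
  ℓ_pos : 0 < D.ℓ
  rhom_pos : 0 < D.rhom
  /-- `P₋ (ρ₀⁻) > P₊ (ρ₀⁻)`: the fluid is denser above the interface. -/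
  rhom_unstable : D.Pp D.rhom < D.Pm D.rhom
  /-- `ρ₀⁺` exists. -/
  rhom_range : D.Pm D.rhom ∈ D.Pp '' Ioi 0
  /-- The steady density is defined down to `x₃ = -m` and up to `x₃ = ℓ`. -/
  depth : enthalpy D.Pm D.rhom + D.g * D.m ∈ enthalpy D.Pm '' Ioi 0
  height : enthalpy D.Pp D.rhop - D.g * D.ℓ ∈ enthalpy D.Pp '' Ioi 0

end FluidData

/-- An element of the real Sobolev space `H₀¹((a, b))`: the continuous representative `toFun`
(automatically in `L²`, as it is continuous on `[a, b]`), vanishing at both endpoints, with a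
representative `wderiv` of its weak derivative, which lies in `L²((a, b))`. -/
structure H10 (a b : ℝ) where
  toFun : ℝ → ℝ
  wderiv : ℝ → ℝ
  continuousOn_toFun : ContinuousOn toFun (Icc a b)
  left_eq_zero : toFun a = 0
  right_eq_zero : toFun b = 0
  memLp_wderiv : MemLp wderiv 2 (volume.restrict (Ioo a b))
  weak_derivative : ∀ χ : ℝ → ℝ, ContDiff ℝ ∞ χ → HasCompactSupport χ → tsupport χ ⊆ Ioo a b →
    ∫ x in Ioo a b, toFun x * deriv χ x = - ∫ x in Ioo a b, wderiv x * χ x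

namespace FluidData

variable (D : FluidData)

/-- The modified energy `E(φ, ψ; s)` at horizontal frequency `k = |ξ|`, with the modified
viscosities `s ε₀` and `s δ₀`. -/
def energy (k s : ℝ) (φ ψ : H10 (-D.m) D.ℓ) : ℝ :=
  D.σ * k ^ 2 / 2 * ψ.toFun 0 ^ 2
  + 1 / 2 * ∫ x in Ioo (-D.m) D.ℓ,
      ((s * D.del0 x + D.dP0 x * D.rho0 x) * (ψ.wderiv x + k * φ.toFun x) ^ 2
        - 2 * D.g * D.rho0 x * k * φ.toFun x * ψ.toFun x)
  + 1 / 2 * ∫ x in Ioo (-D.m) D.ℓ,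
      s * D.eps0 x * ((φ.wderiv x - k * ψ.toFun x) ^ 2 + (ψ.wderiv x - k * φ.toFun x) ^ 2
        + 1 / 3 * (ψ.wderiv x + k * φ.toFun x) ^ 2)

/-- The constraint functional `J(φ, ψ) = ½ ∫ ρ₀ (φ² + ψ²)`. -/
def constraint (φ ψ : H10 (-D.m) D.ℓ) : ℝ :=
  1 / 2 * ∫ x in Ioo (-D.m) D.ℓ, D.rho0 x * (φ.toFun x ^ 2 + ψ.toFun x ^ 2)

/-- The values of `E(·; s)` on the constraint set `𝒜 = {J = 1}`. -/
def energyValues (k s : ℝ) : Set ℝ :=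
  {e | ∃ φ ψ : H10 (-D.m) D.ℓ, D.constraint φ ψ = 1 ∧ e = D.energy k s φ ψ}

/-- `μ(s) = inf {E(φ, ψ; s) : (φ, ψ) ∈ 𝒜}`. -/
def mu (k s : ℝ) : ℝ := sInf (D.energyValues k s)

/-- `𝒮 = μ⁻¹((-∞, 0)) ⊆ (0, ∞)`. -/
def unstableSet (k : ℝ) : Set ℝ := {s | 0 < s ∧ D.mu k s < 0}

/-- `λ(|ξ|, s) = √(-μ(s))`. -/
def growthRate (k s : ℝ) : ℝ := Real.sqrt (-D.mu k s)

end FluidData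

end

end RayleighTaylor

/-! For fixed (φ, ψ) the energy is affine in s: an inviscid part plus s times a nonnegative viscous
part (`weightedEnergy_eq`, `viscousEnergy_nonneg`). So μ, an infimum of such functions, is
nondecreasing and concave, hence continuous, on (0, ∞). It is bounded below by -g|ξ| uniformly in s
(`inviscidEnergy_ge`). Thus s ↦ s² + μ(s) is continuous and strictly increasing, and the solutions
of s = √(-μ(s)) with μ(s) < 0 are exactly its zeros. It is positive for large s, so one point where
it is negative gives existence, and strict monotonicity gives uniqueness; no minimizer is needed.

Negativity for small s follows from one state with negative inviscid energy
(`exists_inviscidEnergy_neg`). Take ψ a bump concentrated at the interface and φ = -ψ'/|ξ|, so that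
the compression ψ' + |ξ|φ vanishes. What remains is surface tension plus g∫ρ₀ψψ', which is close to
(σ|ξ|² - g⟦ρ₀⟧)/2 < 0.

The argument needs only a nonnegative weight c on the shear term, so it is run for general c and
then specialized to the weight (m + ℓ)/2 carried by `energy`. -/

namespace RayleighTaylor

/-! ### Pressure laws, the enthalpy and its inverse -/

section PressureLaw

variable {P : ℝ → ℝ}

lemma IsPressureLaw.continuousOn_deriv (hP : IsPressureLaw P) : ContinuousOn (deriv P) (Ioi 0) :=
  hP.smooth.continuousOn_deriv_of_isOpen isOpen_Ioi (by norm_num)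

/-- Strict monotonicity alone would allow zeros of P'. At such a zero, continuity makes 1/P' exceed
any constant C nearby, while the essential bound holds on a dense set, so at points arbitrarily
close to the zero. -/
lemma IsPressureLaw.deriv_pos (hP : IsPressureLaw P) {z : ℝ} (hz : 0 < z) : 0 < deriv P z := by
  obtain ⟨C, hC⟩ := hP.inv_deriv_locallyBounded (Icc (z / 2) (2 * z)) isCompact_Icc
    (fun x hx => lt_of_lt_of_le (by positivity) hx.1)
  by_contra! h
  have hcont : ContinuousAt (deriv P) z := hP.continuousOn_deriv.continuousAt (Ioi_mem_nhds hz)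
  have hC' : (0 : ℝ) < 1 / ((C : ℝ) + 1) := by positivity
  have hsmall : ∀ᶠ x in nhds z, deriv P x < 1 / ((C : ℝ) + 1) :=
    hcont.eventually (Iio_mem_nhds (lt_of_le_of_lt h hC'))
  have hnhds : ∀ᶠ x in nhds z, x ∈ Ioo (z / 2) (2 * z) :=
    Ioo_mem_nhds (by linarith) (by linarith)
  rw [ae_restrict_iff' measurableSet_Icc] at hC
  have hfreq : ∃ᶠ x in nhds z, x ∈ Icc (z / 2) (2 * z) →
      (ENNReal.ofReal (deriv P x))⁻¹ ≤ (C : ℝ≥0∞) :=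
    mem_closure_iff_frequently.1 (Measure.dense_of_ae hC z)
  obtain ⟨x, hx, hx', hx''⟩ := (hfreq.and_eventually (hsmall.and hnhds)).exists
  have hle := hx ⟨hx''.1.le, hx''.2.le⟩
  have h1 : ((C : ℝ≥0∞) + 1) ≤ (ENNReal.ofReal (deriv P x))⁻¹ := by
    rw [ENNReal.le_inv_iff_le_inv]
    refine (ENNReal.ofReal_le_ofReal hx'.le).trans (le_of_eq ?_)
    rw [one_div, ENNReal.ofReal_inv_of_pos (by positivity)]
    congr 1
    rw [ENNReal.ofReal_add C.coe_nonneg zero_le_one]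
    simp
  have h2 : (C : ℝ≥0∞) + 1 ≤ C := h1.trans hle
  exact absurd h2 (not_le.2 (ENNReal.lt_add_right ENNReal.coe_ne_top one_ne_zero))

lemma IsPressureLaw.hasDerivAt_enthalpy (hP : IsPressureLaw P) {z : ℝ} (hz : 0 < z) :
    HasDerivAt (enthalpy P) (deriv P z / z) z := by
  have hc : ContinuousOn (fun r => deriv P r / r) (Ioi 0) :=
    hP.continuousOn_deriv.div continuousOn_id fun x hx => ne_of_gt hx
  refine intervalIntegral.integral_hasDerivAt_right ?_ ?_ (hc.continuousAt (Ioi_mem_nhds hz))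
  · refine (hc.mono ?_).intervalIntegrable
    intro x hx
    exact lt_of_lt_of_le (lt_min one_pos hz) hx.1
  · exact hc.stronglyMeasurableAtFilter isOpen_Ioi z hz

lemma IsPressureLaw.continuousOn_enthalpy (hP : IsPressureLaw P) :
    ContinuousOn (enthalpy P) (Ioi 0) :=
  fun _ hz => (hP.hasDerivAt_enthalpy hz).continuousAt.continuousWithinAt

lemma IsPressureLaw.strictMonoOn_enthalpy (hP : IsPressureLaw P) :
    StrictMonoOn (enthalpy P) (Ioi 0) := by
  refine strictMonoOn_of_deriv_pos (convex_Ioi 0) hP.continuousOn_enthalpy fun x hx => ?_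
  rw [interior_Ioi] at hx
  rw [(hP.hasDerivAt_enthalpy hx).deriv]
  exact div_pos (hP.deriv_pos hx) hx

/-- The inverse on `(0, ∞)` of a continuous strictly increasing function is continuous. -/
lemma continuousOn_invFunOn {h : ℝ → ℝ} (hc : ContinuousOn h (Ioi 0))
    (hm : StrictMonoOn h (Ioi 0)) :
    ContinuousOn (Function.invFunOn h (Ioi 0)) (h '' Ioi 0) := by
  rintro _ ⟨z, hz, rfl⟩
  have hz : 0 < z := hz
  have hinv : ∀ w ∈ Ioi (0 : ℝ), Function.invFunOn h (Ioi 0) (h w) = w :=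
    fun w hw => hm.injOn.leftInvOn_invFunOn hw
  refine (StrictMonoOn.continuousAt_of_image_mem_nhds (s := h '' Ioi 0) ?_ ?_ ?_).continuousWithinAt
  · rintro _ ⟨a, ha, rfl⟩ _ ⟨b, hb, rfl⟩ hab
    rw [hinv a ha, hinv b hb]
    exact (hm.lt_iff_lt ha hb).1 hab
  -- By the intermediate value theorem the image contains [h(z/2), h(2z)], a neighbourhood of h(z).
  · have hsub : Icc (z / 2) (2 * z) ⊆ Ioi 0 := fun x hx => lt_of_lt_of_le (by positivity) hx.1
    have hI := (intermediate_value_Icc (by linarith) (hc.mono hsub)).trans (image_mono hsub)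
    refine Filter.mem_of_superset (Icc_mem_nhds ?_ ?_) hI
    · exact hm (mem_Ioi.2 (by positivity)) hz (by linarith)
    · exact hm hz (mem_Ioi.2 (by positivity)) (by linarith)
  · rw [hinv z hz]
    refine Filter.mem_of_superset (Ioi_mem_nhds hz) fun w hw => ?_
    exact ⟨h w, ⟨w, hw, rfl⟩, hinv w hw⟩

/-- The density profile in one fluid layer. -/
lemma IsPressureLaw.profile (hP : IsPressureLaw P) {r g a b : ℝ}
    (hI : ∀ x ∈ Icc a b, enthalpy P r - g * x ∈ enthalpy P '' Ioi 0) :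
    ContinuousOn (fun x => Function.invFunOn (enthalpy P) (Ioi 0) (enthalpy P r - g * x))
      (Icc a b) ∧
    MapsTo (fun x => Function.invFunOn (enthalpy P) (Ioi 0) (enthalpy P r - g * x))
      (Icc a b) (Ioi 0) :=
  ⟨(continuousOn_invFunOn hP.continuousOn_enthalpy hP.strictMonoOn_enthalpy).comp
    (by fun_prop) hI, fun x hx => Function.invFunOn_mem (hI x hx)⟩

/-- The range of the enthalpy is an interval, so solvability at the interface and at the outer end
of a layer gives solvability throughout the layer. -/
lemma IsPressureLaw.enthalpy_image_segment (hP : IsPressureLaw P) {u v w : ℝ}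
    (hu : u ∈ enthalpy P '' Ioi 0) (hv : v ∈ enthalpy P '' Ioi 0) (huw : u ≤ w) (hwv : w ≤ v) :
    w ∈ enthalpy P '' Ioi 0 :=
  (isPreconnected_Ioi.image _ hP.continuousOn_enthalpy).ordConnected.out hu hv ⟨huw, hwv⟩

end PressureLaw

/-! ### The steady density and its coefficients: positivity and boundedness -/

namespace FluidData

variable {D : FluidData}

/-- The density profile of the lower fluid, extended up to the interface. -/
noncomputable def rhoLower (D : FluidData) (x : ℝ) : ℝ :=
  Function.invFunOn (enthalpy D.Pm) (Ioi 0) (enthalpy D.Pm D.rhom - D.g * x)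

/-- The density profile of the upper fluid, extended down to the interface. -/
noncomputable def rhoUpper (D : FluidData) (x : ℝ) : ℝ :=
  Function.invFunOn (enthalpy D.Pp) (Ioi 0) (enthalpy D.Pp D.rhop - D.g * x)

lemma rho0_of_neg {x : ℝ} (hx : x < 0) : D.rho0 x = D.rhoLower x := if_pos hx

lemma rho0_of_nonneg {x : ℝ} (hx : 0 ≤ x) : D.rho0 x = D.rhoUpper x := if_neg (not_lt.2 hx)

lemma Admissible.rhop_pos (hD : D.Admissible) : 0 < D.rhop := Function.invFunOn_mem hD.rhom_range

lemma Admissible.rhoLower_prop (hD : D.Admissible) :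
    ContinuousOn D.rhoLower (Icc (-D.m) 0) ∧ MapsTo D.rhoLower (Icc (-D.m) 0) (Ioi 0) := by
  refine hD.pressure_m.profile fun x hx => hD.pressure_m.enthalpy_image_segment
    ⟨D.rhom, hD.rhom_pos, rfl⟩ hD.depth ?_ ?_ <;> nlinarith [hD.g_pos, hx.1, hx.2]

lemma Admissible.rhoUpper_prop (hD : D.Admissible) :
    ContinuousOn D.rhoUpper (Icc 0 D.ℓ) ∧ MapsTo D.rhoUpper (Icc 0 D.ℓ) (Ioi 0) := by
  refine hD.pressure_p.profile fun x hx => hD.pressure_p.enthalpy_image_segment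
    hD.height ⟨D.rhop, hD.rhop_pos, rfl⟩ ?_ ?_ <;> nlinarith [hD.g_pos, hx.1, hx.2]

lemma Admissible.rhoLower_zero (hD : D.Admissible) : D.rhoLower 0 = D.rhom := by
  rw [rhoLower, mul_zero, sub_zero]
  exact hD.pressure_m.strictMonoOn_enthalpy.injOn.leftInvOn_invFunOn hD.rhom_pos

lemma Admissible.rhoUpper_zero (hD : D.Admissible) : D.rhoUpper 0 = D.rhop := by
  rw [rhoUpper, mul_zero, sub_zero]
  exact hD.pressure_p.strictMonoOn_enthalpy.injOn.leftInvOn_invFunOn hD.rhop_pos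

lemma Admissible.rho0_pos (hD : D.Admissible) {x : ℝ} (hx : x ∈ Ioo (-D.m) D.ℓ) :
    0 < D.rho0 x := by
  rcases lt_or_ge x 0 with h | h
  · rw [rho0_of_neg h]; exact hD.rhoLower_prop.2 ⟨hx.1.le, h.le⟩
  · rw [rho0_of_nonneg h]; exact hD.rhoUpper_prop.2 ⟨h, hx.2.le⟩

/-- The Lebesgue measure on the slab `(-m, ℓ)`. -/
noncomputable abbrev slabMeasure (D : FluidData) : Measure ℝ := volume.restrict (Ioo (-D.m) D.ℓ)

/-- A function given by functions of the density in each fluid is bounded and measurable on the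
slab. -/
lemma Admissible.memLp_top_of_comp (hD : D.Admissible) {c F G : ℝ → ℝ}
    (hF : ContinuousOn F (Ioi 0)) (hG : ContinuousOn G (Ioi 0))
    (hneg : ∀ x < 0, c x = F (D.rho0 x)) (hpos : ∀ x ≥ 0, c x = G (D.rho0 x)) :
    MemLp c ⊤ D.slabMeasure := by
  -- The coefficient may jump at 0, but each one-sided piece extends continuously to a compact
  -- interval.
  have h1 : ContinuousOn (fun x => F (D.rhoLower x)) (Icc (-D.m) 0) :=
    hF.comp hD.rhoLower_prop.1 hD.rhoLower_prop.2
  have h2 : ContinuousOn (fun x => G (D.rhoUpper x)) (Icc 0 D.ℓ) :=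
    hG.comp hD.rhoUpper_prop.1 hD.rhoUpper_prop.2
  obtain ⟨C₁, hC₁⟩ := isCompact_Icc.exists_bound_of_continuousOn h1
  obtain ⟨C₂, hC₂⟩ := isCompact_Icc.exists_bound_of_continuousOn h2
  have e1 : EqOn c (fun x => F (D.rhoLower x)) (Ico (-D.m) 0) := fun x hx => by
    rw [hneg x hx.2, rho0_of_neg hx.2]
  have e2 : EqOn c (fun x => G (D.rhoUpper x)) (Icc 0 D.ℓ) := fun x hx => by
    rw [hpos x hx.1, rho0_of_nonneg hx.1]
  refine memLp_top_of_bound ?_ (max C₁ C₂) ?_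
  · have hu : AEStronglyMeasurable c (volume.restrict (Ico (-D.m) 0 ∪ Icc 0 D.ℓ)) := by
      rw [aestronglyMeasurable_union_iff]
      exact ⟨((h1.mono Ico_subset_Icc_self).congr e1).aestronglyMeasurable measurableSet_Ico,
        (h2.congr e2).aestronglyMeasurable measurableSet_Icc⟩
    refine hu.mono_measure (Measure.restrict_mono (fun x hx => ?_) le_rfl)
    rcases lt_or_ge x 0 with h | h
    · exact Or.inl ⟨hx.1.le, h⟩
    · exact Or.inr ⟨h, hx.2.le⟩
  · filter_upwards [ae_restrict_mem measurableSet_Ioo] with x hx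
    rcases lt_or_ge x 0 with h | h
    · rw [e1 ⟨hx.1.le, h⟩]
      exact (hC₁ x ⟨hx.1.le, h.le⟩).trans (le_max_left _ _)
    · rw [e2 ⟨h, hx.2.le⟩]
      exact (hC₂ x ⟨h, hx.2.le⟩).trans (le_max_right _ _)

lemma Admissible.memLp_rho0 (hD : D.Admissible) : MemLp D.rho0 ⊤ D.slabMeasure :=
  hD.memLp_top_of_comp continuousOn_id continuousOn_id (fun _ _ => rfl) fun _ _ => rfl

lemma Admissible.memLp_del0 (hD : D.Admissible) : MemLp D.del0 ⊤ D.slabMeasure :=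
  hD.memLp_top_of_comp hD.delm_smooth.continuousOn hD.delp_smooth.continuousOn
    (fun _ hx => if_pos hx) fun _ hx => if_neg (not_lt.2 hx)

lemma Admissible.memLp_dP0_mul_rho0 (hD : D.Admissible) :
    MemLp (fun x => D.dP0 x * D.rho0 x) ⊤ D.slabMeasure :=
  hD.memLp_top_of_comp (F := fun z => deriv D.Pm z * z) (G := fun z => deriv D.Pp z * z)
    (hD.pressure_m.continuousOn_deriv.mul continuousOn_id)
    (hD.pressure_p.continuousOn_deriv.mul continuousOn_id)
    (fun x hx => by simp only [dP0, if_pos hx])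
    fun x hx => by simp only [dP0, if_neg (not_lt.2 hx)]

lemma Admissible.del0_nonneg (hD : D.Admissible) {x : ℝ} (hx : x ∈ Ioo (-D.m) D.ℓ) :
    0 ≤ D.del0 x := by
  unfold del0
  split_ifs
  exacts [hD.delm_nonneg _ (hD.rho0_pos hx), hD.delp_nonneg _ (hD.rho0_pos hx)]

lemma Admissible.eps0_pos (hD : D.Admissible) {x : ℝ} (hx : x ∈ Ioo (-D.m) D.ℓ) :
    0 < D.eps0 x := by
  unfold eps0
  split_ifs
  exacts [hD.epsm_pos _ (hD.rho0_pos hx), hD.epsp_pos _ (hD.rho0_pos hx)]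

lemma Admissible.dP0_pos (hD : D.Admissible) {x : ℝ} (hx : x ∈ Ioo (-D.m) D.ℓ) :
    0 < D.dP0 x := by
  unfold dP0
  split_ifs
  exacts [hD.pressure_m.deriv_pos (hD.rho0_pos hx), hD.pressure_p.deriv_pos (hD.rho0_pos hx)]

end FluidData

/-! ### Elements of H₀¹ -/

namespace H10

variable {a b : ℝ}

lemma memLp_toFun (u : H10 a b) : MemLp u.toFun 2 (volume.restrict (Ioo a b)) := by
  obtain ⟨C, hC⟩ := isCompact_Icc.exists_bound_of_continuousOn u.continuousOn_toFun
  refine (memLp_top_of_bound (C := C)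
    ((u.continuousOn_toFun.mono Ioo_subset_Icc_self).aestronglyMeasurable measurableSet_Ioo)
    ?_).mono_exponent le_top
  filter_upwards [ae_restrict_mem measurableSet_Ioo] with x hx
  exact hC x (Ioo_subset_Icc_self hx)

/-- Scalar multiples in `H₀¹`. -/
noncomputable def smul (c : ℝ) (u : H10 a b) : H10 a b where
  toFun x := c * u.toFun x
  wderiv x := c * u.wderiv x
  continuousOn_toFun := continuousOn_const.mul u.continuousOn_toFun
  left_eq_zero := by rw [u.left_eq_zero, mul_zero]
  right_eq_zero := by rw [u.right_eq_zero, mul_zero]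
  memLp_wderiv := u.memLp_wderiv.const_mul c
  weak_derivative χ h1 h2 h3 := by
    simp only [mul_assoc]
    rw [integral_const_mul, integral_const_mul, u.weak_derivative χ h1 h2 h3, mul_neg]

/-- A smooth function vanishing at the endpoints, as an element of `H₀¹`. -/
noncomputable def ofContDiff (f : ℝ → ℝ) (hf : ContDiff ℝ ∞ f) (hab : a ≤ b) (ha : f a = 0)
    (hb : f b = 0) : H10 a b where
  toFun := f
  wderiv := deriv f
  continuousOn_toFun := hf.continuous.continuousOn
  left_eq_zero := ha
  right_eq_zero := hb
  memLp_wderiv := by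
    have hc : Continuous (deriv f) := hf.continuous_deriv (by norm_num)
    obtain ⟨C, hC⟩ := isCompact_Icc.exists_bound_of_continuousOn (s := Icc a b) hc.continuousOn
    refine (memLp_top_of_bound (C := C) hc.aestronglyMeasurable ?_).mono_exponent le_top
    filter_upwards [ae_restrict_mem measurableSet_Ioo] with x hx
    exact hC x (Ioo_subset_Icc_self hx)
  weak_derivative χ h1 _ _ := by
    have hd {w : ℝ → ℝ} (hw : ContDiff ℝ ∞ w) (x : ℝ) : HasDerivAt w (deriv w x) x :=
      (hw.differentiable (by norm_num) x).hasDerivAt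
    have hi {w : ℝ → ℝ} (hw : ContDiff ℝ ∞ w) : IntervalIntegrable (deriv w) volume a b :=
      (hw.continuous_deriv (by norm_num)).intervalIntegrable a b
    have key := intervalIntegral.integral_mul_deriv_eq_deriv_mul (a := a) (b := b)
      (fun x _ => hd hf x) (fun x _ => hd h1 x) (hi hf) (hi h1)
    rw [ha, hb, intervalIntegral.integral_of_le hab, intervalIntegral.integral_of_le hab,
      integral_Ioc_eq_integral_Ioo, integral_Ioc_eq_integral_Ioo] at key
    rw [key]
    ring

end H10

/-! ### Splitting the energy in s, with sign and lower bound -/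

namespace FluidData

variable {D : FluidData}

/-- The modified energy with an additional weight `c` on the shear viscosity; the energy with the
actual shear viscosity is the case `c = 1`. -/
noncomputable def weightedEnergy (D : FluidData) (c k s : ℝ) (φ ψ : H10 (-D.m) D.ℓ) : ℝ :=
  D.σ * k ^ 2 / 2 * ψ.toFun 0 ^ 2
  + 1 / 2 * (∫ x in Ioo (-D.m) D.ℓ,
      ((s * D.del0 x + D.dP0 x * D.rho0 x) * (ψ.wderiv x + k * φ.toFun x) ^ 2
        - 2 * D.g * D.rho0 x * k * φ.toFun x * ψ.toFun x))
  + c * (1 / 2 * ∫ x in Ioo (-D.m) D.ℓ,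
      s * D.eps0 x * ((φ.wderiv x - k * ψ.toFun x) ^ 2 + (ψ.wderiv x - k * φ.toFun x) ^ 2
        + 1 / 3 * (ψ.wderiv x + k * φ.toFun x) ^ 2))

/-- The values of the weighted energy on the constraint set. -/
def weightedValues (D : FluidData) (c k s : ℝ) : Set ℝ :=
  {e | ∃ φ ψ : H10 (-D.m) D.ℓ, D.constraint φ ψ = 1 ∧ e = D.weightedEnergy c k s φ ψ}

/-- The infimum of the weighted energy on the constraint set. -/
noncomputable def weightedMu (D : FluidData) (c k s : ℝ) : ℝ := sInf (D.weightedValues c k s)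

/-- The part of the weighted energy that is independent of `s`. -/
noncomputable def inviscidEnergy (D : FluidData) (k : ℝ) (φ ψ : H10 (-D.m) D.ℓ) : ℝ :=
  D.σ * k ^ 2 / 2 * ψ.toFun 0 ^ 2
  + 1 / 2 * ∫ x in Ioo (-D.m) D.ℓ, (D.dP0 x * D.rho0 x * (ψ.wderiv x + k * φ.toFun x) ^ 2
      - 2 * D.g * D.rho0 x * k * φ.toFun x * ψ.toFun x)

/-- The coefficient of `s` in the weighted energy. -/
noncomputable def viscousEnergy (D : FluidData) (c k : ℝ) (φ ψ : H10 (-D.m) D.ℓ) : ℝ :=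
  1 / 2 * (∫ x in Ioo (-D.m) D.ℓ, D.del0 x * (ψ.wderiv x + k * φ.toFun x) ^ 2)
  + c * (1 / 2 * ∫ x in Ioo (-D.m) D.ℓ,
      D.eps0 x * ((φ.wderiv x - k * ψ.toFun x) ^ 2 + (ψ.wderiv x - k * φ.toFun x) ^ 2
        + 1 / 3 * (ψ.wderiv x + k * φ.toFun x) ^ 2))

section Integrability

variable (hD : D.Admissible) (k : ℝ) (φ ψ : H10 (-D.m) D.ℓ)
include hD

lemma Admissible.integrable_stiffness :
    Integrable (fun x => D.dP0 x * D.rho0 x * (ψ.wderiv x + k * φ.toFun x) ^ 2) D.slabMeasure :=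
  (ψ.memLp_wderiv.add (φ.memLp_toFun.const_mul k)).integrable_sq.smul_of_top_right
    hD.memLp_dP0_mul_rho0

lemma Admissible.integrable_bulk :
    Integrable (fun x => D.del0 x * (ψ.wderiv x + k * φ.toFun x) ^ 2) D.slabMeasure :=
  (ψ.memLp_wderiv.add (φ.memLp_toFun.const_mul k)).integrable_sq.smul_of_top_right hD.memLp_del0

lemma Admissible.integrable_buoyancy :
    Integrable (fun x => 2 * D.g * D.rho0 x * k * φ.toFun x * ψ.toFun x) D.slabMeasure := by
  have h : Integrable (fun x => D.rho0 x * (φ.toFun x * ψ.toFun x)) D.slabMeasure :=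
    (φ.memLp_toFun.integrable_mul ψ.memLp_toFun).smul_of_top_right hD.memLp_rho0
  refine (h.const_mul (2 * D.g * k)).congr (ae_of_all _ fun x => ?_)
  ring

lemma Admissible.integrable_constraint :
    Integrable (fun x => D.rho0 x * (φ.toFun x ^ 2 + ψ.toFun x ^ 2)) D.slabMeasure :=
  (φ.memLp_toFun.integrable_sq.add ψ.memLp_toFun.integrable_sq).smul_of_top_right hD.memLp_rho0

lemma Admissible.integrable_inviscid :
    Integrable (fun x => D.dP0 x * D.rho0 x * (ψ.wderiv x + k * φ.toFun x) ^ 2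
      - 2 * D.g * D.rho0 x * k * φ.toFun x * ψ.toFun x) D.slabMeasure :=
  (hD.integrable_stiffness k φ ψ).sub (hD.integrable_buoyancy k φ ψ)

lemma Admissible.integrable_compression (s : ℝ) :
    Integrable (fun x => (s * D.del0 x + D.dP0 x * D.rho0 x) * (ψ.wderiv x + k * φ.toFun x) ^ 2
      - 2 * D.g * D.rho0 x * k * φ.toFun x * ψ.toFun x) D.slabMeasure := by
  refine (((hD.integrable_bulk k φ ψ).const_mul s).add (hD.integrable_inviscid k φ ψ)).congr
    (ae_of_all _ fun x => ?_)
  simp only [Pi.add_apply]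
  ring

/-- In `energy` the shear integral is part of the integrand of the first integral, which gives it
the weight `(m + ℓ) / 2`. -/
lemma Admissible.energy_eq_weightedEnergy (s : ℝ) :
    D.energy k s φ ψ = D.weightedEnergy ((D.m + D.ℓ) / 2) k s φ ψ := by
  unfold energy weightedEnergy
  rw [integral_add (hD.integrable_compression k φ ψ s) (integrable_const _), integral_const,
    measureReal_restrict_apply_univ, Real.volume_real_Ioo_of_le
      (by linarith [hD.m_pos, hD.ℓ_pos]), smul_eq_mul]
  ring

lemma Admissible.weightedEnergy_eq (c s : ℝ) :
    D.weightedEnergy c k s φ ψ = D.inviscidEnergy k φ ψ + s * D.viscousEnergy c k φ ψ := by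
  have e1 : (∫ x in Ioo (-D.m) D.ℓ,
        ((s * D.del0 x + D.dP0 x * D.rho0 x) * (ψ.wderiv x + k * φ.toFun x) ^ 2
          - 2 * D.g * D.rho0 x * k * φ.toFun x * ψ.toFun x))
      = s * (∫ x in Ioo (-D.m) D.ℓ, D.del0 x * (ψ.wderiv x + k * φ.toFun x) ^ 2)
        + ∫ x in Ioo (-D.m) D.ℓ, (D.dP0 x * D.rho0 x * (ψ.wderiv x + k * φ.toFun x) ^ 2
          - 2 * D.g * D.rho0 x * k * φ.toFun x * ψ.toFun x) := by
    rw [← integral_const_mul, ← integral_add ((hD.integrable_bulk k φ ψ).const_mul s)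
      (hD.integrable_inviscid k φ ψ)]
    congr 1 with x
    ring
  have e2 : (∫ x in Ioo (-D.m) D.ℓ, s * D.eps0 x * ((φ.wderiv x - k * ψ.toFun x) ^ 2
        + (ψ.wderiv x - k * φ.toFun x) ^ 2 + 1 / 3 * (ψ.wderiv x + k * φ.toFun x) ^ 2))
      = s * ∫ x in Ioo (-D.m) D.ℓ, D.eps0 x * ((φ.wderiv x - k * ψ.toFun x) ^ 2
        + (ψ.wderiv x - k * φ.toFun x) ^ 2 + 1 / 3 * (ψ.wderiv x + k * φ.toFun x) ^ 2) := by
    rw [← integral_const_mul]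
    congr 1 with x
    ring
  unfold weightedEnergy inviscidEnergy viscousEnergy
  rw [e1, e2]
  ring

lemma Admissible.viscousEnergy_nonneg {c : ℝ} (hc : 0 ≤ c) : 0 ≤ D.viscousEnergy c k φ ψ := by
  refine add_nonneg (mul_nonneg (by norm_num) ?_)
    (mul_nonneg hc (mul_nonneg (by norm_num) ?_))
  · refine setIntegral_nonneg measurableSet_Ioo fun x hx => ?_
    have := hD.del0_nonneg hx
    positivity
  · refine setIntegral_nonneg measurableSet_Ioo fun x hx => ?_
    have := hD.eps0_pos hx
    positivity

/-- Surface tension and compression are nonnegative, and 2φψ ≤ φ² + ψ² controls the buoyancy.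
Besides bounding μ below, this forces J > 0 for any state of negative inviscid energy. -/
lemma Admissible.inviscidEnergy_ge (hk : 0 ≤ k) :
    -(D.g * k) * D.constraint φ ψ ≤ D.inviscidEnergy k φ ψ := by
  have hg := hD.g_pos
  have h : (-(D.g * k)) * (∫ x in Ioo (-D.m) D.ℓ, D.rho0 x * (φ.toFun x ^ 2 + ψ.toFun x ^ 2))
      ≤ ∫ x in Ioo (-D.m) D.ℓ, (D.dP0 x * D.rho0 x * (ψ.wderiv x + k * φ.toFun x) ^ 2
          - 2 * D.g * D.rho0 x * k * φ.toFun x * ψ.toFun x) := by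
    rw [← integral_const_mul]
    refine setIntegral_mono_on ((hD.integrable_constraint φ ψ).const_mul _)
      (hD.integrable_inviscid k φ ψ) measurableSet_Ioo fun x hx => ?_
    have h1 := hD.dP0_pos hx
    have h2 := hD.rho0_pos hx
    have h3 : 0 ≤ D.dP0 x * D.rho0 x * (ψ.wderiv x + k * φ.toFun x) ^ 2 := by positivity
    have h4 : 0 ≤ D.g * k * D.rho0 x * (φ.toFun x - ψ.toFun x) ^ 2 := by positivity
    linarith
  have hσ : 0 ≤ D.σ * k ^ 2 / 2 * ψ.toFun 0 ^ 2 := by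
    have := hD.σ_nonneg
    positivity
  unfold inviscidEnergy constraint
  linarith

end Integrability

/-! ### Scaling, and the fixed point argument -/

lemma inviscidEnergy_smul (k c : ℝ) (φ ψ : H10 (-D.m) D.ℓ) :
    D.inviscidEnergy k (φ.smul c) (ψ.smul c) = c ^ 2 * D.inviscidEnergy k φ ψ := by
  have h : (∫ x in Ioo (-D.m) D.ℓ,
        (D.dP0 x * D.rho0 x * (c * ψ.wderiv x + k * (c * φ.toFun x)) ^ 2
          - 2 * D.g * D.rho0 x * k * (c * φ.toFun x) * (c * ψ.toFun x)))
      = c ^ 2 * ∫ x in Ioo (-D.m) D.ℓ, (D.dP0 x * D.rho0 x * (ψ.wderiv x + k * φ.toFun x) ^ 2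
          - 2 * D.g * D.rho0 x * k * φ.toFun x * ψ.toFun x) := by
    rw [← integral_const_mul]
    congr 1 with x
    ring
  simp only [inviscidEnergy, H10.smul, h]
  ring

lemma constraint_smul (c : ℝ) (φ ψ : H10 (-D.m) D.ℓ) :
    D.constraint (φ.smul c) (ψ.smul c) = c ^ 2 * D.constraint φ ψ := by
  have h : (∫ x in Ioo (-D.m) D.ℓ, D.rho0 x * ((c * φ.toFun x) ^ 2 + (c * ψ.toFun x) ^ 2))
      = c ^ 2 * ∫ x in Ioo (-D.m) D.ℓ, D.rho0 x * (φ.toFun x ^ 2 + ψ.toFun x ^ 2) := by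
    rw [← integral_const_mul]
    congr 1 with x
    ring
  simp only [constraint, H10.smul, h]
  ring

/-- If some state satisfying the constraint has negative inviscid energy, then the infimum `μ(s)`
of the weighted energy is finite and `s = √(-μ(s))` has exactly one solution with `μ(s) < 0`. -/
lemma Admissible.existsUnique_fixedPoint_of_neg (hD : D.Admissible) {c k : ℝ} (hc : 0 ≤ c)
    (hk : 0 ≤ k) {φ₀ ψ₀ : H10 (-D.m) D.ℓ} (hJ : D.constraint φ₀ ψ₀ = 1)
    (hE : D.inviscidEnergy k φ₀ ψ₀ < 0) :
    (∀ s : ℝ, 0 < s → IsGLB (D.weightedValues c k s) (D.weightedMu c k s)) ∧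
    ∃! s : ℝ, (0 < s ∧ D.weightedMu c k s < 0) ∧ 0 < √(-D.weightedMu c k s) ∧
      s = √(-D.weightedMu c k s) := by
  have hne (s : ℝ) : (D.weightedValues c k s).Nonempty := ⟨_, φ₀, ψ₀, hJ, rfl⟩
  have hlow (s : ℝ) (hs : 0 < s) : -(D.g * k) ∈ lowerBounds (D.weightedValues c k s) := by
    rintro _ ⟨φ, ψ, h, rfl⟩
    have h1 := hD.inviscidEnergy_ge k φ ψ hk
    have h2 := mul_nonneg hs.le (hD.viscousEnergy_nonneg k φ ψ hc)
    rw [h, mul_one] at h1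
    rw [hD.weightedEnergy_eq]
    linarith
  have hglb (s : ℝ) (hs : 0 < s) : IsGLB (D.weightedValues c k s) (D.weightedMu c k s) :=
    isGLB_csInf (hne s) ⟨_, hlow s hs⟩
  have hmu_le (s : ℝ) (hs : 0 < s) (φ ψ : H10 (-D.m) D.ℓ) (h : D.constraint φ ψ = 1) :
      D.weightedMu c k s ≤ D.inviscidEnergy k φ ψ + s * D.viscousEnergy c k φ ψ :=
    (hglb s hs).1 ⟨φ, ψ, h, (hD.weightedEnergy_eq k φ ψ c s).symm⟩
  have hle_mu (s : ℝ) (hs : 0 < s) (y : ℝ) (h : ∀ φ ψ : H10 (-D.m) D.ℓ, D.constraint φ ψ = 1 →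
      y ≤ D.inviscidEnergy k φ ψ + s * D.viscousEnergy c k φ ψ) : y ≤ D.weightedMu c k s := by
    refine (hglb s hs).2 ?_
    rintro _ ⟨φ, ψ, hJ, rfl⟩
    rw [hD.weightedEnergy_eq]
    exact h φ ψ hJ
  have hmono : MonotoneOn (D.weightedMu c k) (Ioi 0) := fun s hs t ht hst =>
    hle_mu t ht _ fun φ ψ h => (hmu_le s hs φ ψ h).trans <| by
      gcongr
      exact hD.viscousEnergy_nonneg k φ ψ hc
  -- An infimum of affine functions is concave; on an open interval this yields continuity.
  have hconc : ConcaveOn ℝ (Ioi 0) (D.weightedMu c k) := by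
    refine ⟨convex_Ioi 0, fun s hs t ht a b ha hb hab => ?_⟩
    refine hle_mu _ (convex_Ioi (0 : ℝ) hs ht ha hb hab) _ fun φ ψ h => ?_
    have h1 := mul_le_mul_of_nonneg_left (hmu_le s hs φ ψ h) ha
    have h2 := mul_le_mul_of_nonneg_left (hmu_le t ht φ ψ h) hb
    simp only [smul_eq_mul]
    calc _ ≤ _ := add_le_add h1 h2
      _ = (a + b) * D.inviscidEnergy k φ ψ + (a * s + b * t) * D.viscousEnergy c k φ ψ := by ring
      _ = _ := by rw [hab, one_mul]
  have hcont : ContinuousOn (fun s => s ^ 2 + D.weightedMu c k s) (Ioi 0) :=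
    (continuous_pow 2).continuousOn.add (hconc.continuousOn isOpen_Ioi)
  have hstrict : StrictMonoOn (fun s => s ^ 2 + D.weightedMu c k s) (Ioi 0) := fun s hs t ht hst =>
    add_lt_add_of_lt_of_le (pow_lt_pow_left₀ hst (le_of_lt hs) two_ne_zero) (hmono hs ht hst.le)
  refine ⟨hglb, ?_⟩
  -- As s → 0⁺ the given state's energy tends to its inviscid part, which is negative.
  have hsmall : ∃ s₁ > 0, s₁ ^ 2 + D.weightedMu c k s₁ < 0 := by
    have hcts : ContinuousAt
        (fun s : ℝ => s ^ 2 + (D.inviscidEnergy k φ₀ ψ₀ + s * D.viscousEnergy c k φ₀ ψ₀)) 0 := by fun_prop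
    have h0 : ∀ᶠ s in nhdsWithin (0 : ℝ) (Ioi 0),
        s ^ 2 + (D.inviscidEnergy k φ₀ ψ₀ + s * D.viscousEnergy c k φ₀ ψ₀) < 0 :=
      (hcts.eventually (Iio_mem_nhds (by simpa using hE))).filter_mono nhdsWithin_le_nhds
    obtain ⟨s, hs, hs0⟩ := (h0.and self_mem_nhdsWithin).exists
    exact ⟨s, hs0, lt_of_le_of_lt (by gcongr; exact hmu_le s hs0 φ₀ ψ₀ hJ) hs⟩
  obtain ⟨s₁, hs₁, hneg⟩ := hsmall
  obtain ⟨s₂, hs₂, hpos⟩ : ∃ s₂ > 0, 0 < s₂ ^ 2 + D.weightedMu c k s₂ := by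
    have hgk : 0 ≤ D.g * k := mul_nonneg hD.g_pos.le hk
    have hs : 0 < D.g * k + 1 := by linarith
    -- Since μ ≥ -gk, any s with s² > gk would do.
    refine ⟨D.g * k + 1, hs, ?_⟩
    have : -(D.g * k) ≤ D.weightedMu c k (D.g * k + 1) := (hglb _ hs).2 (hlow _ hs)
    nlinarith
  obtain ⟨s, hs, hroot⟩ : ∃ s ∈ Ioi (0 : ℝ), s ^ 2 + D.weightedMu c k s = 0 :=
    isPreconnected_Ioi.intermediate_value hs₁ hs₂ hcont ⟨hneg.le, hpos.le⟩
  have hs : 0 < s := hs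
  have hrate : √(-D.weightedMu c k s) = s := by
    rw [← eq_neg_of_add_eq_zero_left hroot, Real.sqrt_sq hs.le]
  refine ⟨s, ⟨⟨hs, by nlinarith⟩, hrate.symm ▸ hs, hrate.symm⟩, ?_⟩
  rintro t ⟨⟨ht, htmu⟩, -, hfix⟩
  refine hstrict.injOn ht hs ?_
  have hsq : t ^ 2 = -D.weightedMu c k t := by
    conv_lhs => rw [hfix]
    exact Real.sq_sqrt (by linarith)
  rw [hroot, hsq, neg_add_cancel]

end FluidData

/-! ### The bump function -/

/-- A smooth bump at the origin, increasing before and decreasing after it. -/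
noncomputable def bump (r x : ℝ) : ℝ := Real.smoothTransition (1 - (x / r) ^ 2)

section Bump

variable {r : ℝ}

lemma contDiff_bump : ContDiff ℝ ∞ (bump r) :=
  (Real.smoothTransition.contDiff (n := ⊤)).comp (by fun_prop)

lemma bump_zero : bump r 0 = 1 := by simp [bump, Real.smoothTransition.one]

lemma bump_nonneg (x : ℝ) : 0 ≤ bump r x := Real.smoothTransition.nonneg _

lemma bump_eq_zero (hr : 0 < r) {x : ℝ} (hx : r ≤ |x|) : bump r x = 0 := by
  refine Real.smoothTransition.zero_of_nonpos ?_
  have h : 1 ≤ |x / r| := by rwa [abs_div, abs_of_pos hr, le_div_iff₀ hr, one_mul]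
  have := one_le_sq_iff_one_le_abs (x / r) |>.2 h
  linarith

lemma hasDerivAt_bump (x : ℝ) : HasDerivAt (bump r) (deriv (bump r) x) x :=
  (contDiff_bump.differentiable (by norm_num) x).hasDerivAt

lemma deriv_bump (x : ℝ) :
    deriv (bump r) x = deriv Real.smoothTransition (1 - (x / r) ^ 2) * (-(2 * x / r ^ 2)) := by
  have h1 : HasDerivAt (fun x : ℝ => 1 - (x / r) ^ 2) (-(2 * x / r ^ 2)) x := by
    refine ((((hasDerivAt_id' x).div_const r).fun_pow 2).const_sub 1).congr_deriv ?_
    simp only [Nat.cast_ofNat, Nat.add_one_sub_one, pow_one]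
    ring
  have h2 : HasDerivAt Real.smoothTransition (deriv Real.smoothTransition (1 - (x / r) ^ 2))
      (1 - (x / r) ^ 2) :=
    ((Real.smoothTransition.contDiff (n := ⊤)).differentiable (by norm_num) _).hasDerivAt
  exact (h2.comp x h1).deriv

lemma deriv_bump_nonneg {x : ℝ} (hx : x ≤ 0) : 0 ≤ deriv (bump r) x := by
  rw [deriv_bump]
  refine mul_nonneg Real.smoothTransition.monotone.deriv_nonneg ?_
  rw [neg_nonneg]
  exact div_nonpos_of_nonpos_of_nonneg (by linarith) (sq_nonneg r)

lemma deriv_bump_nonpos {x : ℝ} (hx : 0 ≤ x) : deriv (bump r) x ≤ 0 := by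
  rw [deriv_bump]
  refine mul_nonpos_of_nonneg_of_nonpos Real.smoothTransition.monotone.deriv_nonneg ?_
  rw [neg_nonpos]
  positivity

lemma deriv_bump_eq_zero (hr : 0 < r) {x : ℝ} (hx : r < |x|) : deriv (bump r) x = 0 := by
  have h : bump r =ᶠ[nhds x] fun _ => 0 := by
    filter_upwards [(isOpen_lt continuous_const continuous_abs).mem_nhds hx] with y hy
    exact bump_eq_zero hr (le_of_lt hy)
  rw [h.deriv_eq, deriv_const]

lemma continuous_deriv_bump : Continuous (deriv (bump r)) :=
  contDiff_bump.continuous_deriv (by norm_num)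

lemma integral_bump_mul_deriv (a b : ℝ) :
    ∫ x in a..b, bump r x * deriv (bump r) x = bump r b ^ 2 / 2 - bump r a ^ 2 / 2 := by
  refine intervalIntegral.integral_eq_sub_of_hasDerivAt (f := fun x => bump r x ^ 2 / 2)
    (fun x _ => ?_) ((contDiff_bump.continuous.mul continuous_deriv_bump).intervalIntegrable a b)
  refine (((hasDerivAt_bump (r := r) x).fun_pow 2).div_const 2).congr_deriv ?_
  simp only [Nat.cast_ofNat, Nat.add_one_sub_one, pow_one]
  ring

end Bump

/-! ### A state of negative inviscid energy -/

namespace FluidData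

variable {D : FluidData}

/-- Close to the interface, the density is close to its one-sided limits. -/
lemma Admissible.exists_rho0_near (hD : D.Admissible) {η : ℝ} (hη : 0 < η) :
    ∃ r > 0, r < D.m ∧ r < D.ℓ ∧ (∀ x, -r ≤ x → x < 0 → D.rho0 x ≤ D.rhom + η) ∧
      ∀ x, 0 ≤ x → x ≤ r → D.rhop - η ≤ D.rho0 x := by
  have h1 : ∀ᶠ x in nhdsWithin 0 (Icc (-D.m) 0), D.rhoLower x < D.rhom + η := by
    refine (hD.rhoLower_prop.1 0 ⟨by linarith [hD.m_pos], le_rfl⟩).eventually_lt_const ?_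
    rw [hD.rhoLower_zero]
    linarith
  have h2 : ∀ᶠ x in nhdsWithin 0 (Icc 0 D.ℓ), D.rhop - η < D.rhoUpper x := by
    refine (hD.rhoUpper_prop.1 0 ⟨le_rfl, hD.ℓ_pos.le⟩).eventually_const_lt ?_
    rw [hD.rhoUpper_zero]
    linarith
  rw [eventually_nhdsWithin_iff, Metric.eventually_nhds_iff] at h1 h2
  obtain ⟨r₁, hr₁, h1⟩ := h1
  obtain ⟨r₂, hr₂, h2⟩ := h2
  have hm := hD.m_pos
  have hl := hD.ℓ_pos
  have hpos : 0 < min (min r₁ r₂) (min D.m D.ℓ) := lt_min (lt_min hr₁ hr₂) (lt_min hm hl)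
  set q := min (min r₁ r₂) (min D.m D.ℓ) with hq
  have q1 : q ≤ r₁ := (min_le_left _ _).trans (min_le_left _ _)
  have q2 : q ≤ r₂ := (min_le_left _ _).trans (min_le_right _ _)
  have q3 : q ≤ D.m := (min_le_right _ _).trans (min_le_left _ _)
  have q4 : q ≤ D.ℓ := (min_le_right _ _).trans (min_le_right _ _)
  refine ⟨q / 2, by linarith, by linarith, by linarith, fun x hx hx0 => ?_, fun x hx0 hx => ?_⟩
  · rw [rho0_of_neg hx0]
    refine (h1 ?_ ⟨by linarith, hx0.le⟩).le
    rw [Real.dist_eq, sub_zero, abs_of_neg hx0]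
    linarith
  · rw [rho0_of_nonneg hx0]
    refine (h2 ?_ ⟨hx0, by linarith⟩).le
    rw [Real.dist_eq, sub_zero, abs_of_nonneg hx0]
    linarith

/-- With b the bump, bb' = (b²/2)' has integral 1/2 below the interface and -1/2 above it. It keeps
its sign on each side, so the one-sided density bounds can be inserted directly; beyond distance r
it vanishes and no bound is needed. -/
lemma Admissible.integral_rho0_bump_le (hD : D.Admissible) {r η : ℝ} (hr : 0 < r) (hm : r < D.m)
    (hl : r < D.ℓ) (h1 : ∀ x, -r ≤ x → x < 0 → D.rho0 x ≤ D.rhom + η)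
    (h2 : ∀ x, 0 ≤ x → x ≤ r → D.rhop - η ≤ D.rho0 x) :
    ∫ x in Ioo (-D.m) D.ℓ, D.rho0 x * (bump r x * deriv (bump r) x)
      ≤ (D.rhom + η) / 2 - (D.rhop - η) / 2 := by
  have hcont : Continuous fun x => bump r x * deriv (bump r) x :=
    contDiff_bump.continuous.mul continuous_deriv_bump
  have hint : IntegrableOn (fun x => D.rho0 x * (bump r x * deriv (bump r) x))
      (Ioo (-D.m) D.ℓ) := by
    have : IntegrableOn (fun x => bump r x * deriv (bump r) x) (Ioo (-D.m) D.ℓ) :=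
      (hcont.integrableOn_Icc).mono_set Ioo_subset_Icc_self
    exact this.smul_of_top_right hD.memLp_rho0
  have hm0 := hD.m_pos
  have hl0 := hD.ℓ_pos
  have hsplit : Ioo (-D.m) D.ℓ = Ioo (-D.m) 0 ∪ Ico 0 D.ℓ :=
    (Ioo_union_Ico_eq_Ioo (by linarith) hl0.le).symm
  have hdisj : Disjoint (Ioo (-D.m) 0) (Ico 0 D.ℓ) :=
    Set.disjoint_left.2 fun x hx hx' => absurd hx.2 (not_lt.2 hx'.1)
  have hi1 := hint.mono_set (hsplit ▸ subset_union_left : Ioo (-D.m) 0 ⊆ Ioo (-D.m) D.ℓ)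
  have hi2 := hint.mono_set (hsplit ▸ subset_union_right : Ico 0 D.ℓ ⊆ Ioo (-D.m) D.ℓ)
  have hb1 : ∫ x in Ioo (-D.m) 0, bump r x * deriv (bump r) x = 1 / 2 := by
    rw [← integral_Ioc_eq_integral_Ioo, ← intervalIntegral.integral_of_le (by linarith),
      integral_bump_mul_deriv, bump_zero,
      bump_eq_zero hr (by rw [abs_neg, abs_of_pos hm0]; exact hm.le)]
    norm_num
  have hb2 : ∫ x in Ico 0 D.ℓ, bump r x * deriv (bump r) x = -(1 / 2) := by
    rw [integral_Ico_eq_integral_Ioo, ← integral_Ioc_eq_integral_Ioo,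
      ← intervalIntegral.integral_of_le hl0.le, integral_bump_mul_deriv, bump_zero,
      bump_eq_zero hr (by rw [abs_of_pos hl0]; exact hl.le)]
    norm_num
  have hle1 : ∫ x in Ioo (-D.m) 0, D.rho0 x * (bump r x * deriv (bump r) x)
      ≤ (D.rhom + η) * (1 / 2) := by
    rw [← hb1, ← integral_const_mul]
    refine setIntegral_mono_on hi1 ((hcont.const_mul _).integrableOn_Icc.mono_set
      Ioo_subset_Icc_self) measurableSet_Ioo fun x hx => ?_
    rcases lt_or_ge x (-r) with h | h
    · rw [bump_eq_zero hr (by rw [abs_of_neg hx.2]; linarith)]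
      simp
    · exact mul_le_mul_of_nonneg_right (h1 x h hx.2)
        (mul_nonneg (bump_nonneg x) (deriv_bump_nonneg hx.2.le))
  have hle2 : ∫ x in Ico 0 D.ℓ, D.rho0 x * (bump r x * deriv (bump r) x)
      ≤ (D.rhop - η) * (-(1 / 2)) := by
    rw [← hb2, ← integral_const_mul]
    refine setIntegral_mono_on hi2 ((hcont.const_mul _).integrableOn_Icc.mono_set
      Ico_subset_Icc_self) measurableSet_Ico fun x hx => ?_
    rcases lt_or_ge r x with h | h
    · rw [bump_eq_zero hr (by rw [abs_of_nonneg hx.1]; exact h.le)]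
      simp
    · exact mul_le_mul_of_nonpos_right (h2 x hx.1 h)
        (mul_nonpos_of_nonneg_of_nonpos (bump_nonneg x) (deriv_bump_nonpos hx.1))
  rw [hsplit, setIntegral_union hdisj measurableSet_Ico hi1 hi2]
  linarith

/-- Below the critical frequency some state satisfying the constraint has negative inviscid
energy. -/
lemma Admissible.exists_inviscidEnergy_neg (hD : D.Admissible) {k : ℝ} (hk : 0 < k)
    (hcrit : D.σ * k ^ 2 < D.g * D.jumpRho) :
    ∃ φ ψ : H10 (-D.m) D.ℓ, D.constraint φ ψ = 1 ∧ D.inviscidEnergy k φ ψ < 0 := by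
  have hg := hD.g_pos
  obtain ⟨η, hη, hgη⟩ : ∃ η > 0, D.σ * k ^ 2 + 2 * (D.g * η) < D.g * D.jumpRho := by
    -- With this η, the error 2gη uses up half of the gap g⟦ρ₀⟧ - σk².
    refine ⟨(D.g * D.jumpRho - D.σ * k ^ 2) / (4 * D.g), div_pos (by linarith) (by linarith), ?_⟩
    have : D.g * ((D.g * D.jumpRho - D.σ * k ^ 2) / (4 * D.g))
        = (D.g * D.jumpRho - D.σ * k ^ 2) / 4 := by
      field_simp
    rw [this]
    linarith
  obtain ⟨r, hr, hrm, hrl, h1, h2⟩ := hD.exists_rho0_near hη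
  have hm := hD.m_pos
  have hl := hD.ℓ_pos
  have hle : -D.m ≤ D.ℓ := by linarith
  have ham : r < |-D.m| := by rwa [abs_neg, abs_of_pos hm]
  have hal : r < |D.ℓ| := by rwa [abs_of_pos hl]
  let ψ : H10 (-D.m) D.ℓ := H10.ofContDiff (bump r) contDiff_bump hle
    (bump_eq_zero hr ham.le) (bump_eq_zero hr hal.le)
  -- The choice φ = -ψ'/k cancels ψ' + kφ and turns the buoyancy -2gρ₀kφψ into 2gρ₀ψψ'.
  let φ : H10 (-D.m) D.ℓ := (H10.ofContDiff (deriv (bump r))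
    ((contDiff_infty_iff_deriv.1 contDiff_bump).2) hle
    (deriv_bump_eq_zero hr ham) (deriv_bump_eq_zero hr hal)).smul (-(1 / k))
  have hψ : ψ.toFun = bump r := rfl
  have hψ' : ψ.wderiv = deriv (bump r) := rfl
  have hφ (x : ℝ) : φ.toFun x = -(1 / k) * deriv (bump r) x := rfl
  have hE : D.inviscidEnergy k φ ψ < 0 := by
    have hI : (∫ x in Ioo (-D.m) D.ℓ, (D.dP0 x * D.rho0 x * (ψ.wderiv x + k * φ.toFun x) ^ 2
          - 2 * D.g * D.rho0 x * k * φ.toFun x * ψ.toFun x))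
        = 2 * D.g * ∫ x in Ioo (-D.m) D.ℓ, D.rho0 x * (bump r x * deriv (bump r) x) := by
      rw [← integral_const_mul]
      congr 1 with x
      rw [hφ, hψ, hψ']
      field_simp
      ring
    have hb := mul_le_mul_of_nonneg_left (hD.integral_rho0_bump_le hr hrm hrl h1 h2) hg.le
    have hj : D.jumpRho = D.rhop - D.rhom := rfl
    rw [hj] at hgη
    rw [inviscidEnergy, hI, hψ, bump_zero]
    linarith
  have hJ : 0 < D.constraint φ ψ := by
    have hnn : 0 ≤ D.constraint φ ψ := by
      refine mul_nonneg (by norm_num) (setIntegral_nonneg measurableSet_Ioo fun x hx => ?_)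
      have := hD.rho0_pos hx
      positivity
    have := hD.inviscidEnergy_ge k φ ψ hk.le
    have hgk : 0 < D.g * k := mul_pos hg hk
    -- If J = 0, the lower bound -gkJ would make the inviscid energy nonnegative.
    by_contra! h
    nlinarith
  -- Both functionals are quadratic, so normalizing to J = 1 preserves the sign of the energy.
  refine ⟨φ.smul (√(D.constraint φ ψ))⁻¹, ψ.smul (√(D.constraint φ ψ))⁻¹, ?_, ?_⟩
  · rw [constraint_smul, inv_pow, Real.sq_sqrt hJ.le, inv_mul_cancel₀ hJ.ne']
  · rw [inviscidEnergy_smul]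
    exact mul_neg_of_pos_of_neg (by positivity) hE

/-- Inversion of the label `s` for an arbitrary weight on the shear viscosity. -/
theorem Admissible.existsUnique_fixedPoint (hD : D.Admissible) {c k : ℝ} (hc : 0 ≤ c) (hk : 0 < k)
    (hcrit : D.σ * k ^ 2 < D.g * D.jumpRho) :
    (∀ s : ℝ, 0 < s → IsGLB (D.weightedValues c k s) (D.weightedMu c k s)) ∧
    ∃! s : ℝ, (0 < s ∧ D.weightedMu c k s < 0) ∧ 0 < √(-D.weightedMu c k s) ∧
      s = √(-D.weightedMu c k s) := by
  obtain ⟨φ, ψ, hJ, hE⟩ := hD.exists_inviscidEnergy_neg hk hcrit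
  exact hD.existsUnique_fixedPoint_of_neg hc hk.le hJ hE

lemma Admissible.energyValues_eq (hD : D.Admissible) (k s : ℝ) :
    D.energyValues k s = D.weightedValues ((D.m + D.ℓ) / 2) k s := by
  simp only [energyValues, weightedValues, hD.energy_eq_weightedEnergy]

end FluidData

end RayleighTaylor

theorem mainTheorem2 (D : RayleighTaylor.FluidData) (hD : D.Admissible)
    (ξ : EuclideanSpace ℝ (Fin 2)) (hξ : 0 < ‖ξ‖) (hξ' : D.σ * ‖ξ‖ ^ 2 < D.g * D.jumpRho) :
    (∀ s : ℝ, 0 < s → IsGLB (D.energyValues ‖ξ‖ s) (D.mu ‖ξ‖ s)) ∧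
    ∃! s : ℝ, s ∈ D.unstableSet ‖ξ‖ ∧ 0 < D.growthRate ‖ξ‖ s ∧ s = D.growthRate ‖ξ‖ s := by
  -- Nonnegativity is all that the general result asks of the shear weight.
  have hc : 0 ≤ (D.m + D.ℓ) / 2 := by linarith [hD.m_pos, hD.ℓ_pos]
  have hmu (s : ℝ) : D.mu ‖ξ‖ s = D.weightedMu ((D.m + D.ℓ) / 2) ‖ξ‖ s := by
    rw [RayleighTaylor.FluidData.mu, hD.energyValues_eq, RayleighTaylor.FluidData.weightedMu]
  simp only [RayleighTaylor.FluidData.unstableSet, RayleighTaylor.FluidData.growthRate, hmu,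
    hD.energyValues_eq, mem_ofPred_eq]
  exact hD.existsUnique_fixedPoint hc hξ hξ'
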